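/- Let $p$ and $m$ be positive integers and $r$ an integer such that $r^p\equiv 1 \pmod m$, and let $G=\langle x,y \mid x^p=y^m=1,\ x^{-1}yx=y^r\rangle$, so that $G\cong C_p\ltimes C_m$ with $\langle y\rangle\cong C_m$. Suppose that $p$ is the smallest prime divisor of $|G|$ and that $\gcd(p(r-1),m)=1$. Then the small Davenport constant of $G$ is $\mathsf d(G)=m+p-2$; that is, $m+p-2$ is the maximal length of a finite unordered sequence over $G$ (repetition of terms allowed) that has no nonempty subsequence whose terms can be multiplied in some order to give $1$. -/

import Mathlib

/-! Sequences over a group are finite and unordered, with repetition allowed, that is, multisets: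
the length of `S` is `Multiset.card S`, and `T` is a subsequence of `S` iff `T ≤ S`. -/

/-- The set `π(S)` of products of all the terms of `S`, taken in any order. -/
def seqProducts {G : Type*} [Group G] (S : Multiset G) : Set G :=
  {g | ∃ l : List G, (l : Multiset G) = S ∧ l.prod = g}

/-- The set `Π(S)` of products of all nonempty subsequences of `S`, the terms of each
subsequence being multiplied in any order. -/
def subseqProducts {G : Type*} [Group G] (S : Multiset G) : Set G :=
  {g | ∃ T : Multiset G, T ≤ S ∧ 1 ≤ Multiset.card T ∧ g ∈ seqProducts T}

/-- `S` has no nonempty product-one subsequence. -/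
def IsProductOneFree {G : Type*} [Group G] (S : Multiset G) : Prop :=
  (1 : G) ∉ subseqProducts S

/-- `d` is the small Davenport constant of `G`: the maximal length of a product-one free sequence
over `G`. In particular the maximum is required to exist. -/
def IsSmallDavenportConstant (G : Type*) [Group G] (d : ℕ) : Prop :=
  IsGreatest {n : ℕ | ∃ S : Multiset G, Multiset.card S = n ∧ IsProductOneFree S} d

/-- The relators of the presentation `⟨x, y ∣ x ^ p = y ^ m = 1, x⁻¹ y x = y ^ r⟩`, where the
generator `x` is indexed by `0` and `y` by `1`. -/
def metacyclicRels (p m : ℕ) (r : ℤ) : Set (FreeGroup (Fin 2)) :=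
  {FreeGroup.of 0 ^ p, FreeGroup.of 1 ^ m,
    (FreeGroup.of 0)⁻¹ * FreeGroup.of 1 * FreeGroup.of 0 * (FreeGroup.of 1 ^ r)⁻¹}

/-- The group `⟨x, y ∣ x ^ p = y ^ m = 1, x⁻¹ y x = y ^ r⟩`. -/
abbrev MetacyclicGroup (p m : ℕ) (r : ℤ) : Type :=
  PresentedGroup (metacyclicRels p m r)

/-! The sequence of `m - 1` copies of `y` and `p - 1` copies of `x` gives the lower bound. For the
upper bound, `⟨y⟩` is the abelian kernel of the map to `C_p`, and the gcd condition makes the action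
fixed-point-free: nothing outside `⟨y⟩` commutes with a nontrivial element of it.

From `p` terms one can extract a shortest block `T` whose product lies in `⟨y⟩`. Its cyclic
rotations have conjugate products, and fixed-point-freeness makes these `|T|` products distinct. If
the sequence is product-one free, Kemperman–Scherk applies to the product sets of disjoint blocks,
each block `T` enlarging the set of attained elements of `⟨y⟩` by at least `|T|`. At most `p - 1`
terms remain at the end, so `|S| - (p - 1) + 1 ≤ m`. -/

open scoped Pointwise

/-! ### Product sets in abelian groups -/

/-- The Kemperman–Scherk theorem for abelian groups. -/
theorem Finset.card_add_card_le_card_mul_add_one {N : Type*} [CommGroup N] [DecidableEq N]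
    (A B : Finset N) (hA : 1 ∈ A) (hB : 1 ∈ B)
    (h : ∀ a ∈ A, ∀ b ∈ B, a * b = 1 → a = 1 ∧ b = 1) :
    A.card + B.card ≤ (A * B).card + 1 := by
  induction hn : B.card using Nat.strong_induction_on generalizing A B with
  | _ n ih =>
  subst hn
  -- If `A` absorbs multiplication by `B`, then `A * b = A` contains `1` for each `b ∈ B`, which
  -- forces `b = 1`. Otherwise some Dyson `e`-transform strictly shrinks `B`, preserves the sum of
  -- cardinalities and does not enlarge the product set beyond `A * B`.
  by_cases hsub : ∀ e ∈ A, e • B ⊆ A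
  · have hB1 : B = {1} := by
      refine Finset.eq_singleton_iff_unique_mem.2 ⟨hB, fun b hb => ?_⟩
      have himg : A.image (· * b) = A := by
        refine Finset.eq_of_subset_of_card_le ?_ ?_
        · intro c hc
          obtain ⟨a, ha, rfl⟩ := Finset.mem_image.1 hc
          exact hsub a ha (Finset.smul_mem_smul_finset hb)
        · rw [Finset.card_image_of_injective _ (mul_left_injective b)]
      rw [← himg] at hA
      obtain ⟨a, ha, hab⟩ := Finset.mem_image.1 hA
      exact (h a ha b hb hab).2
    subst hB1
    simp
  · push Not at hsub
    obtain ⟨e, he, hne⟩ := hsub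
    have hcard := Finset.mulDysonETransform.card e (A, B)
    have hle := Finset.card_le_card (Finset.mulDysonETransform.subset e (A, B))
    simp only [Finset.mulDysonETransform_fst, Finset.mulDysonETransform_snd] at hcard hle
    have hlt : (B ∩ e⁻¹ • A).card < B.card := by
      refine Finset.card_lt_card ⟨Finset.inter_subset_left, fun hs => hne fun c hc => ?_⟩
      obtain ⟨b, hb, rfl⟩ := Finset.mem_smul_finset.1 hc
      have := (Finset.mem_inter.1 (hs hb)).2
      rwa [Finset.mem_inv_smul_finset_iff] at this
    have key := ih _ hlt (A ∪ e • B) (B ∩ e⁻¹ • A) (Finset.mem_union_left _ hA)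
      (Finset.mem_inter.2 ⟨hB, by rw [Finset.mem_inv_smul_finset_iff]; simpa using he⟩) ?_ rfl
    · omega
    -- The hypothesis survives the transform: if `a' = e * b`, then `(e * b') * b = 1` with `e * b'
    -- ∈ A`, so `b = 1` and `e * b' = 1`, whence `e = b' = 1`.
    · intro a' ha b' hb hab
      obtain ⟨hb1, hb2⟩ := Finset.mem_inter.1 hb
      rcases Finset.mem_union.1 ha with ha | ha
      · exact h a' ha b' hb1 hab
      · obtain ⟨b, hb, rfl⟩ := Finset.mem_smul_finset.1 ha
        rw [Finset.mem_inv_smul_finset_iff, smul_eq_mul] at hb2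
        rw [smul_eq_mul] at hab ⊢
        obtain ⟨h1, rfl⟩ := h _ hb2 b hb (by rw [← hab]; ac_rfl)
        obtain ⟨rfl, rfl⟩ := h e he b' hb1 h1
        simp

/-! ### Product-one free sequences and abelian Frobenius kernels -/

/-- A list of length at least `|Q|` has a nonempty infix with trivial image in `Q` whose proper
prefix products are pairwise distinct in `Q`. -/
theorem List.exists_infix_map_prod_eq_one {G Q : Type*} [Group G] [Group Q] [Finite Q]
    (φ : G →* Q) (L : List G) (hL : Nat.card Q ≤ L.length) :
    ∃ T : List G, T <:+: L ∧ T ≠ [] ∧ φ T.prod = 1 ∧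
      ∀ i j, i < j → j < T.length → φ (T.take i).prod ≠ φ (T.take j).prod := by
  have hseg : ∀ (T : List G) (i j : ℕ), i < j → j ≤ T.length →
      φ (T.take i).prod = φ (T.take j).prod →
      ((T.take j).drop i <:+: T ∧ (T.take j).drop i ≠ []) ∧ φ ((T.take j).drop i).prod = 1 := by
    intro T i j hij hj heq
    refine ⟨⟨(List.drop_suffix _ _).isInfix.trans (List.take_prefix _ _).isInfix, ?_⟩, ?_⟩
    · intro h0
      have := congrArg List.length h0
      simp at this
      omega
    · have h1 := List.prod_take_mul_prod_drop (T.take j) i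
      rw [List.take_take, min_eq_left hij.le] at h1
      have h2 := congrArg φ h1
      rw [map_mul, heq] at h2
      exact mul_eq_left.1 h2
  have hex : ∃ n, ∃ T : List G, T.length = n ∧ T <:+: L ∧ T ≠ [] ∧ φ T.prod = 1 := by
    have hcard : Nat.card Q < Nat.card (Fin (L.length + 1)) := by simp; omega
    have hni : ¬ Function.Injective (fun i : Fin (L.length + 1) => φ (L.take i).prod) := fun hi =>
      absurd (Nat.card_le_card_of_injective _ hi) (by omega)
    simp only [Function.Injective, not_forall] at hni
    obtain ⟨i, j, heq, hne⟩ := hni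
    rcases lt_or_gt_of_ne hne with hij | hij
    · obtain ⟨⟨h1, h2⟩, h3⟩ := hseg L i j hij (by omega) heq
      exact ⟨_, _, rfl, h1, h2, h3⟩
    · obtain ⟨⟨h1, h2⟩, h3⟩ := hseg L j i hij (by omega) heq.symm
      exact ⟨_, _, rfl, h1, h2, h3⟩
  classical
  -- Take an infix of minimal length: a repetition among its proper prefixes would cut out a shorter
  -- one.
  obtain ⟨T, hTn, hTL, hT0, hT1⟩ := Nat.find_spec hex
  refine ⟨T, hTL, hT0, hT1, fun i j hij hj heq => ?_⟩
  obtain ⟨⟨h1, h2⟩, h3⟩ := hseg T i j hij hj.le heq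
  refine Nat.find_min hex (m := ((T.take j).drop i).length) ?_ ⟨_, rfl, h1.trans hTL, h2, h3⟩
  rw [← hTn, List.length_drop, List.length_take]
  omega

theorem IsProductOneFree.mono {G : Type*} [Group G] {S T : Multiset G} (hS : IsProductOneFree S)
    (hT : T ≤ S) : IsProductOneFree T :=
  fun ⟨U, hU, h⟩ => hS ⟨U, hU.trans hT, h⟩

theorem mul_mem_seqProducts_add {G : Type*} [Group G] {S T : Multiset G} {a b : G}
    (ha : a ∈ seqProducts S) (hb : b ∈ seqProducts T) : a * b ∈ seqProducts (S + T) := by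
  obtain ⟨k, rfl, rfl⟩ := ha
  obtain ⟨l, rfl, rfl⟩ := hb
  exact ⟨k ++ l, rfl, List.prod_append⟩

theorem IsProductOneFree.eq_zero {G : Type*} [Group G] {S T : Multiset G}
    (hS : IsProductOneFree S) (hT : T ≤ S) (h : 1 ∈ seqProducts T) : T = 0 := by
  by_contra h0
  exact hS ⟨T, hT, Multiset.card_pos.2 h0, h⟩

theorem eq_one_of_mem_seqProducts_zero {G : Type*} [Group G] {g : G}
    (h : g ∈ seqProducts (0 : Multiset G)) : g = 1 := by
  obtain ⟨l, hl, rfl⟩ := h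
  rw [Multiset.coe_eq_zero] at hl
  simp [hl]

/-- The rotations of a list with product `g` in the kernel of `φ`, and with prefix products that are
pairwise distinct modulo this kernel, have pairwise distinct products. -/
theorem exists_finset_ker_of_injOn_prefix {G Q : Type*} [Group G] [Group Q] [DecidableEq G]
    (φ : G →* Q) (hfrob : ∀ z h : G, φ z ≠ 1 → φ h = 1 → Commute z h → h = 1)
    (T : List G) (hφ : φ T.prod = 1) (hT : T.prod ≠ 1)
    (hinj : ∀ i j, i < j → j < T.length → φ (T.take i).prod ≠ φ (T.take j).prod) :
    ∃ A : Finset φ.ker, A.card = T.length ∧ 1 ∉ A ∧ ∀ a ∈ A, (a : G) ∈ seqProducts (T : Multiset G) := by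
  classical
  set P : ℕ → G := fun i => (T.take i).prod with hP
  have hmem : ∀ i, (P i)⁻¹ * T.prod * P i ∈ φ.ker := fun i => by
    simp [MonoidHom.mem_ker, hφ]
  let f : ℕ → φ.ker := fun i => ⟨(P i)⁻¹ * T.prod * P i, hmem i⟩
  have hne : ∀ i j, i < j → j < T.length → f i ≠ f j := by
    intro i j hij hj heq
    have heq' : (P i)⁻¹ * T.prod * P i = (P j)⁻¹ * T.prod * P j := congrArg Subtype.val heq
    -- Equal rotations mean that `P j * (P i)⁻¹`, which lies outside the kernel, commutes with the
    -- product of `T`.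
    refine hT (hfrob (P j * (P i)⁻¹) T.prod ?_ hφ ?_)
    · intro h1
      rw [map_mul, map_inv, mul_inv_eq_one] at h1
      exact hinj i j hij hj h1.symm
    · have : P j * ((P i)⁻¹ * T.prod * P i) * (P i)⁻¹ = P j * ((P j)⁻¹ * T.prod * P j) * (P i)⁻¹ := by
        rw [heq']
      simpa [Commute, SemiconjBy, mul_assoc] using this
  refine ⟨(Finset.range T.length).image f, ?_, ?_, ?_⟩
  · rw [Finset.card_image_of_injOn, Finset.card_range]
    intro i hi j hj heq
    rw [Finset.mem_coe, Finset.mem_range] at hi hj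
    by_contra hij
    rcases lt_or_gt_of_ne hij with hij | hij
    · exact hne i j hij hj heq
    · exact hne j i hij hi heq.symm
  · intro h1
    obtain ⟨i, -, hi⟩ := Finset.mem_image.1 h1
    have hi' : (P i)⁻¹ * T.prod * P i = 1 := congrArg Subtype.val hi
    apply hT
    rwa [mul_assoc, inv_mul_eq_one, eq_comm, mul_eq_right] at hi'
  · intro a ha
    obtain ⟨i, -, rfl⟩ := Finset.mem_image.1 ha
    refine ⟨T.drop i ++ T.take i, ?_, ?_⟩
    · rw [Multiset.coe_eq_coe]
      exact List.perm_append_comm.trans (by rw [List.take_append_drop])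
    · rw [List.prod_append]
      change _ = (P i)⁻¹ * T.prod * P i
      rw [← List.prod_take_mul_prod_drop T i, inv_mul_cancel_left]

open scoped IsMulCommutative in
/-- A product-one free sequence has many subsequence products in an abelian Frobenius kernel. -/
theorem IsProductOneFree.exists_finset_ker {G Q : Type*} [Group G] [Group Q] [Finite Q]
    (φ : G →* Q) [IsMulCommutative φ.ker]
    (hfrob : ∀ z h : G, φ z ≠ 1 → φ h = 1 → Commute z h → h = 1)
    (S : Multiset G) (hS : IsProductOneFree S) :
    ∃ B : Finset φ.ker, 1 ∈ B ∧ S.card + 2 ≤ B.card + Nat.card Q ∧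
      ∀ b ∈ B, ∃ T ≤ S, (b : G) ∈ seqProducts T := by
  classical
  induction hn : S.card using Nat.strong_induction_on generalizing S with
  | _ n ih =>
  subst hn
  by_cases hcard : S.card < Nat.card Q
  -- With at most `|Q| - 1` terms left, the empty product alone meets the bound.
  · refine ⟨{1}, Finset.mem_singleton_self 1, by simp; omega, fun b hb => ⟨0, zero_le, ?_⟩⟩
    rw [Finset.mem_singleton.1 hb]
    exact ⟨[], rfl, rfl⟩
  · obtain ⟨L, rfl⟩ := Quot.exists_rep S
    change IsProductOneFree (L : Multiset G) at hS
    obtain ⟨T, ⟨L₁, L₂, rfl⟩, hT0, hTφ, hTinj⟩ :=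
      L.exists_infix_map_prod_eq_one φ (not_lt.1 hcard)
    set U : Multiset G := ((L₁ ++ L₂ : List G) : Multiset G) with hU
    have hsplit : ((L₁ ++ T ++ L₂ : List G) : Multiset G) = (T : Multiset G) + U := by
      rw [hU, Multiset.coe_add, Multiset.coe_eq_coe]
      exact (List.perm_append_comm.append_right L₂).trans (by rw [List.append_assoc])
    change ∃ B : Finset φ.ker, 1 ∈ B ∧ Multiset.card ((L₁ ++ T ++ L₂ : List G) : Multiset G) + 2 ≤ _ ∧
      ∀ b ∈ B, ∃ T' ≤ ((L₁ ++ T ++ L₂ : List G) : Multiset G), (b : G) ∈ seqProducts T'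
    change ∀ m < Multiset.card ((L₁ ++ T ++ L₂ : List G) : Multiset G), _ at ih
    rw [hsplit] at hS ih ⊢
    have hTlen : 0 < T.length := List.length_pos_iff.2 hT0
    have hT1 : T.prod ≠ 1 := fun h1 => by
      have := hS.eq_zero (T := T) (Multiset.le_add_right _ _) ⟨T, rfl, h1⟩
      exact hT0 (by simpa using this)
    obtain ⟨A, hAcard, hA1, hA⟩ := exists_finset_ker_of_injOn_prefix φ hfrob T hTφ hT1 hTinj
    obtain ⟨B, hB1, hBcard, hB⟩ := ih U.card (by simp [Multiset.card_add]; omega) U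
      (hS.mono (Multiset.le_add_left _ _)) rfl
    have hA' : ∀ a ∈ insert 1 A, ∃ V ≤ (T : Multiset G), (a : G) ∈ seqProducts V := by
      intro a ha
      rcases Finset.mem_insert.1 ha with rfl | ha
      · exact ⟨0, zero_le, [], rfl, rfl⟩
      · exact ⟨T, le_rfl, hA a ha⟩
    -- Since `1 ∉ A`, the first set has `|T| + 1` elements, so the product set gains at least `|T|`
    -- over `B`. A nontrivial relation `a * b = 1` would exhibit a product-one subsequence.
    have key := Finset.card_add_card_le_card_mul_add_one (insert 1 A) B
      (Finset.mem_insert_self _ _) hB1 ?_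
    · refine ⟨insert 1 A * B, ?_, ?_, ?_⟩
      · simpa using Finset.mul_mem_mul (Finset.mem_insert_self 1 A) hB1
      · rw [Finset.card_insert_of_notMem hA1] at key
        rw [Multiset.card_add, Multiset.coe_card]
        omega
      · intro c hc
        obtain ⟨a, ha, b, hb, rfl⟩ := Finset.mem_mul.1 hc
        obtain ⟨V, hV, haV⟩ := hA' a ha
        obtain ⟨W, hW, hbW⟩ := hB b hb
        exact ⟨V + W, add_le_add hV hW, mul_mem_seqProducts_add haV hbW⟩
    · intro a ha b hb hab
      obtain ⟨V, hV, haV⟩ := hA' a ha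
      obtain ⟨W, hW, hbW⟩ := hB b hb
      have hVW := hS.eq_zero (add_le_add hV hW) (by
        have := mul_mem_seqProducts_add haV hbW
        rwa [← Subgroup.coe_mul, hab] at this)
      obtain ⟨rfl, rfl⟩ := add_eq_zero.1 hVW
      exact ⟨Subtype.ext (eq_one_of_mem_seqProducts_zero haV),
        Subtype.ext (eq_one_of_mem_seqProducts_zero hbW)⟩

theorem IsProductOneFree.card_add_two_le {G Q : Type*} [Group G] [Group Q] [Finite Q]
    (φ : G →* Q) [Finite φ.ker] [IsMulCommutative φ.ker]
    (hfrob : ∀ z h : G, φ z ≠ 1 → φ h = 1 → Commute z h → h = 1)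
    {S : Multiset G} (hS : IsProductOneFree S) :
    S.card + 2 ≤ Nat.card φ.ker + Nat.card Q := by
  obtain ⟨B, -, hB, -⟩ := hS.exists_finset_ker φ hfrob
  have := Nat.card_le_card_of_injective (Subtype.val : B → φ.ker) Subtype.val_injective
  rw [Nat.card_eq_fintype_card (α := B), Fintype.card_coe] at this
  omega

/-! ### Structure of the presented group -/

namespace MetacyclicGroup

variable (p m : ℕ) (r : ℤ)

/-- The generator `x`. -/
def x : MetacyclicGroup p m r := PresentedGroup.of 0

/-- The generator `y`. -/
def y : MetacyclicGroup p m r := PresentedGroup.of 1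

theorem x_pow : x p m r ^ p = 1 :=
  PresentedGroup.one_of_mem (rels := metacyclicRels p m r) (x := FreeGroup.of 0 ^ p)
    (by simp [metacyclicRels])

theorem y_pow : y p m r ^ m = 1 :=
  PresentedGroup.one_of_mem (rels := metacyclicRels p m r) (x := FreeGroup.of 1 ^ m)
    (by simp [metacyclicRels])

theorem inv_x_mul_y_mul_x : (x p m r)⁻¹ * y p m r * x p m r = y p m r ^ r := by
  have h := PresentedGroup.one_of_mem (rels := metacyclicRels p m r)
    (x := (FreeGroup.of 0)⁻¹ * FreeGroup.of 1 * FreeGroup.of 0 * (FreeGroup.of 1 ^ r)⁻¹)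
    (by simp [metacyclicRels])
  simp only [map_mul, map_inv, map_zpow, mul_inv_eq_one] at h
  exact h

variable {p m r}

/-- The homomorphism defined by images of the generators that satisfy the relations. -/
def lift {K : Type*} [Group K] (u v : K) (hu : u ^ p = 1) (hv : v ^ m = 1)
    (huv : u⁻¹ * v * u = v ^ r) : MetacyclicGroup p m r →* K :=
  PresentedGroup.toGroup (f := ![u, v]) (by
    rintro w (rfl | rfl | rfl) <;> simp [hu, hv, huv])

section lift

variable {K : Type*} [Group K] (u v : K) (hu : u ^ p = 1) (hv : v ^ m = 1)
  (huv : u⁻¹ * v * u = v ^ r)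

@[simp]
theorem lift_x : lift u v hu hv huv (x p m r) = u := PresentedGroup.toGroup.of _

@[simp]
theorem lift_y : lift u v hu hv huv (y p m r) = v := PresentedGroup.toGroup.of _

end lift

theorem inv_x_mul_y_zpow_mul_x (b : ℤ) :
    (x p m r)⁻¹ * y p m r ^ b * x p m r = y p m r ^ (r * b) := by
  have h := conj_zpow (a := (x p m r)⁻¹) (b := y p m r) (i := b)
  rw [inv_inv, inv_x_mul_y_mul_x, ← zpow_mul] at h
  exact h.symm

/-- Every element has the form `x ^ a * y ^ b`. -/
theorem exists_eq_x_pow_mul_y_zpow (hp : p ≠ 0) (g : MetacyclicGroup p m r) :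
    ∃ (a : ℕ) (b : ℤ), g = x p m r ^ a * y p m r ^ b := by
  have hx : ∀ g : MetacyclicGroup p m r, (∃ (a : ℕ) (b : ℤ), g = x p m r ^ a * y p m r ^ b) →
      ∃ (a : ℕ) (b : ℤ), g * x p m r = x p m r ^ a * y p m r ^ b := by
    rintro _ ⟨a, b, rfl⟩
    refine ⟨a + 1, r * b, ?_⟩
    rw [← inv_x_mul_y_zpow_mul_x, pow_succ]
    group
  have hxn : ∀ (n : ℕ) (g : MetacyclicGroup p m r),
      (∃ (a : ℕ) (b : ℤ), g = x p m r ^ a * y p m r ^ b) →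
      ∃ (a : ℕ) (b : ℤ), g * x p m r ^ n = x p m r ^ a * y p m r ^ b := by
    intro n
    induction n with
    | zero => simp
    | succ n ih =>
      intro g hg
      rw [pow_succ, ← mul_assoc]
      exact hx _ (ih g hg)
  have hxinv : (x p m r)⁻¹ = x p m r ^ (p - 1) := by
    rw [inv_eq_iff_mul_eq_one, ← pow_succ', Nat.sub_add_cancel (Nat.pos_of_ne_zero hp), x_pow]
  have htop : g ∈ Subgroup.closure (Set.range (PresentedGroup.of (rels := metacyclicRels p m r))) := by
    rw [PresentedGroup.closure_range_of]
    trivial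
  induction htop using Subgroup.closure_induction_right with
  | one => exact ⟨0, 0, by simp⟩
  | mul_right g _ w hw ih =>
    obtain ⟨i, rfl⟩ := hw
    fin_cases i
    · exact hx g ih
    · obtain ⟨a, b, rfl⟩ := ih
      exact ⟨a, b + 1, by rw [zpow_add_one, mul_assoc]; rfl⟩
  | mul_inv_cancel g _ w hw ih =>
    obtain ⟨i, rfl⟩ := hw
    fin_cases i
    · change ∃ (a : ℕ) (b : ℤ), g * (x p m r)⁻¹ = _
      rw [hxinv]
      exact hxn _ _ ih
    · obtain ⟨a, b, rfl⟩ := ih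
      exact ⟨a, b - 1, by rw [zpow_sub_one, mul_assoc]; rfl⟩

variable (p m r) in
/-- The quotient map onto the cyclic group generated by `x`. -/
def toCyclic : MetacyclicGroup p m r →* Multiplicative (ZMod p) :=
  lift (Multiplicative.ofAdd 1) 1 (by rw [← ofAdd_nsmul]; simp) (by simp) (by simp)

@[simp]
theorem toCyclic_x : toCyclic p m r (x p m r) = Multiplicative.ofAdd 1 := lift_x ..

@[simp]
theorem toCyclic_y : toCyclic p m r (y p m r) = 1 := lift_y ..

theorem toCyclic_x_pow_eq_one_iff (a : ℕ) : toCyclic p m r (x p m r ^ a) = 1 ↔ p ∣ a := by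
  rw [map_pow, toCyclic_x, ← ofAdd_nsmul, ofAdd_eq_one, nsmul_one, ZMod.natCast_eq_zero_iff]

theorem ker_toCyclic (hp : p ≠ 0) : (toCyclic p m r).ker = Subgroup.zpowers (y p m r) := by
  refine le_antisymm (fun g hg => ?_) ?_
  · obtain ⟨a, b, rfl⟩ := exists_eq_x_pow_mul_y_zpow hp g
    rw [MonoidHom.mem_ker, map_mul, map_zpow, toCyclic_y, one_zpow, mul_one,
      toCyclic_x_pow_eq_one_iff] at hg
    obtain ⟨c, rfl⟩ := hg
    rw [pow_mul, x_pow, one_pow, one_mul]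
    exact Subgroup.zpow_mem_zpowers _ _
  · rw [Subgroup.zpowers_le, MonoidHom.mem_ker, toCyclic_y]

/-- Conjugation by `x` raises `y ^ b` to the power `r`, so if the two commute, the order of `y ^ b`
divides both `r - 1` and `m`. -/
theorem eq_one_of_commute_x (hgcd : Int.gcd (r - 1) m = 1) (b : ℤ)
    (h : Commute (x p m r) (y p m r ^ b)) : y p m r ^ b = 1 := by
  have h1 : y p m r ^ (r * b) = y p m r ^ b := by
    rw [← inv_x_mul_y_zpow_mul_x, mul_assoc, ← h.eq, inv_mul_cancel_left]
  have h2 : (y p m r ^ b) ^ (r - 1) = 1 := by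
    rw [← zpow_mul, show b * (r - 1) = r * b - b by ring, zpow_sub, h1, mul_inv_cancel]
  have h3 : (y p m r ^ b) ^ (m : ℤ) = 1 := by
    rw [← zpow_mul, mul_comm, zpow_mul, zpow_natCast, y_pow, one_zpow]
  have h4 := orderOf_dvd_iff_zpow_eq_one.2 h2
  have h5 := orderOf_dvd_iff_zpow_eq_one.2 h3
  have h6 := Int.dvd_coe_gcd h4 h5
  rw [hgcd] at h6
  exact orderOf_eq_one_iff.1 (Nat.dvd_one.1 (by exact_mod_cast h6))

/-- The Frobenius condition on `⟨y⟩`. In `z = x ^ a * y ^ c` the factor `y ^ c` is harmless, and as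
`a` is prime to `p`, `x` is itself a power of `x ^ a`. -/
theorem eq_one_of_commute (hp : p.Prime) (hgcd : Int.gcd (r - 1) m = 1)
    (z h : MetacyclicGroup p m r) (hz : toCyclic p m r z ≠ 1) (hh : toCyclic p m r h = 1)
    (hzh : Commute z h) : h = 1 := by
  rw [← MonoidHom.mem_ker, ker_toCyclic hp.ne_zero] at hh
  obtain ⟨b, rfl⟩ := Subgroup.mem_zpowers_iff.1 hh
  obtain ⟨a, c, rfl⟩ := exists_eq_x_pow_mul_y_zpow hp.ne_zero z
  have ha : ¬ p ∣ a := by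
    rwa [map_mul, map_zpow, toCyclic_y, one_zpow, mul_one, Ne, toCyclic_x_pow_eq_one_iff] at hz
  have hc : Commute (y p m r ^ c) (y p m r ^ b) := (Commute.refl _).zpow_zpow _ _
  have hxa : Commute (x p m r ^ a) (y p m r ^ b) := by
    simpa using hzh.mul_left hc.inv_left
  have hcop : Nat.Coprime a p := ((Nat.Prime.coprime_iff_not_dvd hp).2 ha).symm
  have hbez := Nat.gcd_eq_gcd_ab a p
  rw [hcop.gcd_eq_one] at hbez
  have hx : x p m r = (x p m r ^ a) ^ (a.gcdA p) := by
    calc x p m r = x p m r ^ (((1 : ℕ) : ℤ)) := by simp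
      _ = _ := by
        rw [hbez, zpow_add, zpow_mul, zpow_mul, zpow_natCast, zpow_natCast, x_pow, one_zpow,
          mul_one]
  refine eq_one_of_commute_x hgcd b ?_
  rw [hx]
  exact hxa.zpow_left _

/-- The relations do not collapse `⟨y⟩`, because `y` acts as translation by `1` in a representation
by affine permutations of `ZMod m`. -/
theorem orderOf_y (hr : r ^ p ≡ 1 [ZMOD (m : ℤ)]) (hp : p ≠ 0) :
    orderOf (y p m r) = m := by
  have hr' : (r : ZMod m) ^ p = 1 := by
    have := (ZMod.intCast_eq_intCast_iff _ _ _).2 hr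
    simpa using this
  let w : (ZMod m)ˣ := Units.ofPowEqOne (r : ZMod m) p hr' hp
  have hw : (w : ZMod m) = r := rfl
  have hwp : w ^ p = 1 := Units.pow_ofPowEqOne hr' hp
  -- Multiplication by `r⁻¹`, not `r`, so that `u⁻¹ * v * u` is translation by `r`.
  let u : Equiv.Perm (ZMod m) := (MulAction.toPermHom (ZMod m)ˣ (ZMod m) w)⁻¹
  let v : Equiv.Perm (ZMod m) := Equiv.addRight 1
  have hvn : ∀ (n : ℤ) (t : ZMod m), (v ^ n) t = t + n := by
    intro n t
    simp [v]
  let ψ : MetacyclicGroup p m r →* Equiv.Perm (ZMod m) := lift u v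
    (by rw [inv_pow, ← map_pow, hwp, map_one, inv_one])
    (by ext t; rw [← zpow_natCast, hvn]; simp)
    (by
      ext t
      rw [hvn]
      change w • (w⁻¹ • t + 1) = t + (r : ZMod m)
      rw [smul_add, smul_inv_smul, Units.smul_def, hw, smul_eq_mul, mul_one])
  have hψ : ψ (y p m r) = v := lift_y _ _ _ _ _
  refine Nat.dvd_antisymm (orderOf_dvd_of_pow_eq_one (y_pow p m r)) ?_
  have h1 : ψ (y p m r ^ orderOf (y p m r)) = 1 := by rw [pow_orderOf_eq_one, map_one]
  rw [map_pow, hψ, ← zpow_natCast] at h1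
  have h2 := congrArg (fun e : Equiv.Perm (ZMod m) => e 0) h1
  simp only [hvn] at h2
  simpa [ZMod.natCast_eq_zero_iff] using h2

/-- In the quotient `C_p`, a product-one subsequence must use a multiple of `p` copies of `x`, hence
none; it is then a power of `y` with exponent below `m`. -/
theorem isProductOneFree_replicate (hm : m ≠ 0) (hp : p ≠ 0) (hr : r ^ p ≡ 1 [ZMOD (m : ℤ)]) :
    IsProductOneFree (Multiset.replicate (m - 1) (y p m r) +
      Multiset.replicate (p - 1) (x p m r)) := by
  classical
  rintro ⟨T, hT, hcard, l, rfl, hl⟩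
  obtain ⟨i, j, hi, hj, hij⟩ : ∃ i j, i ≤ m - 1 ∧ j ≤ p - 1 ∧
      (l : Multiset (MetacyclicGroup p m r)) =
        Multiset.replicate i (y p m r) + Multiset.replicate j (x p m r) := by
    obtain ⟨i, hi, hi'⟩ := Multiset.le_replicate_iff.1
      (Multiset.inter_le_right (s := l) (t := Multiset.replicate (m - 1) (y p m r)))
    obtain ⟨j, hj, hj'⟩ := Multiset.le_replicate_iff.1 (tsub_le_iff_left.2 hT)
    exact ⟨i, j, hi, hj, by rw [← hi', ← hj', add_comm, Multiset.sub_add_inter]⟩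
  have hφ := congrArg (toCyclic p m r) hl
  rw [map_list_prod, ← Multiset.prod_coe, ← Multiset.map_coe, hij] at hφ
  simp only [Multiset.map_add, Multiset.map_replicate, Multiset.prod_add, Multiset.prod_replicate,
    toCyclic_y, one_pow, one_mul, map_one] at hφ
  rw [← map_pow, toCyclic_x_pow_eq_one_iff] at hφ
  obtain rfl : j = 0 := Nat.eq_zero_of_dvd_of_lt hφ (by omega)
  rw [Multiset.replicate_zero, add_zero, ← Multiset.coe_replicate, Multiset.coe_eq_coe,
    List.perm_replicate] at hij
  rw [hij, List.prod_replicate] at hl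
  have hi0 := Nat.eq_zero_of_dvd_of_lt
    (orderOf_y hr hp ▸ orderOf_dvd_of_pow_eq_one hl) (by omega)
  simp [hij, hi0] at hcard

end MetacyclicGroup

/-! ### The small Davenport constant -/

theorem proposition3p5 (p m : ℕ) (r : ℤ)
    (hr : r ^ p ≡ 1 [ZMOD (m : ℤ)])
    (hp : IsLeast {q : ℕ | q.Prime ∧ q ∣ Nat.card (MetacyclicGroup p m r)} p)
    (hgcd : Int.gcd ((p : ℤ) * (r - 1)) (m : ℤ) = 1) :
    IsSmallDavenportConstant (MetacyclicGroup p m r) (m + p - 2) := by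
  have hpp : p.Prime := hp.1.1
  have hm : m ≠ 0 := by
    rintro rfl
    rw [Nat.cast_zero, Int.gcd_zero_right, Int.natAbs_mul, Int.natAbs_natCast] at hgcd
    exact hpp.one_lt.ne' (Nat.eq_one_of_mul_eq_one_right hgcd)
  have hgcd' : Int.gcd (r - 1) m = 1 :=
    Nat.eq_one_of_dvd_one (hgcd ▸ Int.gcd_dvd_gcd_mul_left_left ..)
  have hp2 := hpp.two_le
  refine ⟨⟨_, ?_, MetacyclicGroup.isProductOneFree_replicate hm hpp.ne_zero hr⟩, ?_⟩
  · rw [Multiset.card_add, Multiset.card_replicate, Multiset.card_replicate]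
    omega
  · rintro _ ⟨S, rfl, hS⟩
    have hker := MetacyclicGroup.ker_toCyclic (m := m) (r := r) hpp.ne_zero
    have hcard : Nat.card (MetacyclicGroup.toCyclic p m r).ker = m := by
      rw [hker, Nat.card_zpowers, MetacyclicGroup.orderOf_y hr hpp.ne_zero]
    have : NeZero p := ⟨hpp.ne_zero⟩
    have : Finite (MetacyclicGroup.toCyclic p m r).ker :=
      Nat.finite_of_card_ne_zero (by rwa [hcard])
    have : IsMulCommutative (MetacyclicGroup.toCyclic p m r).ker := by
      rw [hker]
      infer_instance
    have := hS.card_add_two_le (MetacyclicGroup.toCyclic p m r)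
      (MetacyclicGroup.eq_one_of_commute hpp hgcd')
    rw [hcard, Nat.card_congr Multiplicative.toAdd, Nat.card_zmod] at this
    omega
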